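/- Let $x:[0,1]\to\mathbb R$ be continuous. For $p>0$ and $n\in\mathbb N$ put $$V_n^{(p)}=\sum_{k=0}^{2^n-1}\bigl|x((k+1)2^{-n})-x(k2^{-n})\bigr|^p .$$ We say that $x$ admits the Hurst roughness exponent $H$ if there is $q\in[1,\infty)$ with $H=1/q$ such that $\lim_{n\to\infty}V_n^{(p)}=0$ for every $p>q$ and $\lim_{n\to\infty}V_n^{(p)}=\infty$ for every $0<p<q$ (so that $x$ is not constant). Let $$\theta_{m,k}=2^{m/2}\Bigl(2x\bigl(\tfrac{2k+1}{2^{m+1}}\bigr)-x\bigl(\tfrac{k}{2^m}\bigr)-x\bigl(\tfrac{k+1}{2^m}\bigr)\Bigr),\qquad m\ge 0,\ 0\le k\le 2^m-1,$$ be the Faber–Schauder coefficients of $x$, and let $$s_n=\Bigl(\sum_{m=0}^{n-1}\sum_{k=0}^{2^m-1}\theta_{m,k}^2\Bigr)^{1/2},\qquad \xi_n=\frac1n\log_2 s_n .$$ **Proposition.** Suppose that $x$ admits the Hurst roughness exponent $H$ and that the limit $\xi=\lim_{n\to\infty}\xi_n$ exists in $\mathbb R$. Then: 1. if $\xi>1/2$,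 then $H\le 1/2$; if $\xi<1/2$, then $H\ge 1/2$; 2. if $H\le 1/2$, then $H\le 1-\xi$; 3. if $H\ge 1/2$, then $H\ge 1-\xi$. -/

import Mathlib

open Filter Topology

noncomputable section

/-- The `p`-th variation of `x` sampled along the `n`-th dyadic partition of `[0,1]`. -/
def dyadicVariation (x : ℝ → ℝ) (p : ℝ) (n : ℕ) : ℝ :=
  ∑ k ∈ Finset.range (2 ^ n), |x (((k : ℝ) + 1) / 2 ^ n) - x ((k : ℝ) / 2 ^ n)| ^ p

/-- `x` admits the Hurst roughness exponent `H`: there is a `q ∈ [1, ∞)` with `H = 1 / q` such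
that the dyadic `p`-th variation tends to `0` for all `p > q` and to `∞` for all `0 < p < q`. -/
def HasHurstRoughnessExponent (x : ℝ → ℝ) (H : ℝ) : Prop :=
  ∃ q : ℝ, 1 ≤ q ∧ H = 1 / q ∧
    (∀ p : ℝ, q < p → Tendsto (dyadicVariation x p) atTop (𝓝 0)) ∧
    (∀ p : ℝ, 0 < p → p < q → Tendsto (dyadicVariation x p) atTop atTop)

/-- The Faber--Schauder coefficient `θ_{m,k}` of `x`; the factor is `2 ^ (m / 2)` with the real
exponent `m / 2`. -/
def faberSchauderCoeff (x : ℝ → ℝ) (m k : ℕ) : ℝ :=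
  (2 : ℝ) ^ ((m : ℝ) / 2) *
    (2 * x ((2 * (k : ℝ) + 1) / 2 ^ (m + 1)) - x ((k : ℝ) / 2 ^ m) - x (((k : ℝ) + 1) / 2 ^ m))

/-- `s_n`, the square root of the sum of the squared coefficients of generations `m < n`. -/
def gladyshevS (x : ℝ → ℝ) (n : ℕ) : ℝ :=
  √(∑ m ∈ Finset.range n, ∑ k ∈ Finset.range (2 ^ m), faberSchauderCoeff x m k ^ 2)

/-- `ξ_n = (1 / n) log₂ s_n`. The `s_n` are non-decreasing, and they all vanish only for affine `x`;
for all other `x`, `s_n > 0` for large `n`, so that the limit of `ξ_n` involves no logarithm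
of `0`. -/
def gladyshevXi (x : ℝ → ℝ) (n : ℕ) : ℝ :=
  1 / (n : ℝ) * Real.logb 2 (gladyshevS x n)

end

/-! The sum defining `s_n ^ 2` telescopes to `2 ^ n * V_n - V_0` with `V` the quadratic variation
(`gladyshevS_sq`), so `V_n` grows roughly like `2 ^ (n * (2 * ξ - 1))`. The sign of `ξ - 1/2` thus
forbids `V_n → 0` or `V_n → ∞`, which places `q` relative to 2. The power mean inequality between
exponents 2 and `p` turns the behaviour of the `p`-th variation into a bound between `ξ` and `1 -
1/p`; letting `p → q` finishes. -/

lemma dyadicVariation_nonneg (x : ℝ → ℝ) (p : ℝ) (n : ℕ) : 0 ≤ dyadicVariation x p n :=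
  Finset.sum_nonneg fun _ _ => by positivity

lemma sum_range_two_mul (f : ℕ → ℝ) (n : ℕ) :
    ∑ k ∈ Finset.range (2 * n), f k = ∑ k ∈ Finset.range n, (f (2 * k) + f (2 * k + 1)) := by
  induction n with
  | zero => simp
  | succ n ih =>
    rw [show 2 * (n + 1) = 2 * n + 1 + 1 by ring, Finset.sum_range_succ, Finset.sum_range_succ, ih,
      Finset.sum_range_succ]
    ring

lemma dyadicVariation_two_eq (x : ℝ → ℝ) (n : ℕ) :
    dyadicVariation x 2 n =
      ∑ k ∈ Finset.range (2 ^ n), (x (((k : ℝ) + 1) / 2 ^ n) - x ((k : ℝ) / 2 ^ n)) ^ 2 := by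
  unfold dyadicVariation
  simp

/-- Parallelogram law: if `a`, `b` are the increments over the two halves of a dyadic interval, the
coefficient is `2 ^ (m / 2) * (a - b)`, and `(a - b)² = 2 * (a² + b²) - (a + b)²`. -/
lemma sum_faberSchauderCoeff_sq (x : ℝ → ℝ) (m : ℕ) :
    ∑ k ∈ Finset.range (2 ^ m), faberSchauderCoeff x m k ^ 2 =
      2 ^ (m + 1) * dyadicVariation x 2 (m + 1) - 2 ^ m * dyadicVariation x 2 m := by
  rw [dyadicVariation_two_eq, dyadicVariation_two_eq, pow_succ' 2 m, pow_succ' 2 m,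
    sum_range_two_mul, Finset.mul_sum, Finset.mul_sum, ← Finset.sum_sub_distrib]
  refine Finset.sum_congr rfl fun k _ => ?_
  have h2 : ((2 : ℝ) ^ ((m : ℝ) / 2)) ^ 2 = 2 ^ m := by
    rw [← Real.rpow_natCast, ← Real.rpow_mul (by norm_num), ← Real.rpow_natCast]
    congr 1
    push_cast
    ring
  have e1 : ((2 * k : ℕ) : ℝ) / (2 * 2 ^ m) = (k : ℝ) / 2 ^ m := by
    push_cast
    rw [mul_div_mul_left _ _ two_ne_zero]
  have e2 : (((2 * k + 1 : ℕ) : ℝ) + 1) / (2 * 2 ^ m) = ((k : ℝ) + 1) / 2 ^ m := by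
    rw [← mul_div_mul_left _ _ (two_ne_zero (α := ℝ))]
    push_cast
    ring
  rw [faberSchauderCoeff, mul_pow, h2, e1, e2, pow_succ' 2 m]
  push_cast
  ring

lemma gladyshevS_nonneg (x : ℝ → ℝ) (n : ℕ) : 0 ≤ gladyshevS x n := Real.sqrt_nonneg _

lemma gladyshevS_mono (x : ℝ → ℝ) : Monotone (gladyshevS x) := fun _ _ h =>
  Real.sqrt_le_sqrt <| Finset.sum_le_sum_of_subset_of_nonneg (Finset.range_mono h)
    fun _ _ _ => Finset.sum_nonneg fun _ _ => sq_nonneg _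

lemma gladyshevS_sq (x : ℝ → ℝ) (n : ℕ) :
    gladyshevS x n ^ 2 = 2 ^ n * dyadicVariation x 2 n - dyadicVariation x 2 0 := by
  rw [gladyshevS, Real.sq_sqrt
    (Finset.sum_nonneg fun _ _ => Finset.sum_nonneg fun _ _ => sq_nonneg _),
    Finset.sum_congr rfl fun m _ => sum_faberSchauderCoeff_sq x m,
    Finset.sum_range_sub fun m => 2 ^ m * dyadicVariation x 2 m]
  simp

/-- The power mean inequality for dyadic variations. -/
lemma dyadicVariation_rpow_le (x : ℝ → ℝ) {r p : ℝ} (hr : 0 < r) (hp : r ≤ p) (n : ℕ) :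
    dyadicVariation x r n ^ (p / r) ≤
      ((2 : ℝ) ^ n) ^ (p / r - 1) * dyadicVariation x p n := by
  have h := Real.rpow_sum_le_const_mul_sum_rpow (Finset.range (2 ^ n))
    (fun k => |x (((k : ℝ) + 1) / 2 ^ n) - x ((k : ℝ) / 2 ^ n)| ^ r) ((one_le_div hr).2 hp)
  simp only [abs_of_nonneg (Real.rpow_nonneg (abs_nonneg _) r), Finset.card_range,
    ← Real.rpow_mul (abs_nonneg _), mul_div_cancel₀ p hr.ne'] at h
  simpa only [dyadicVariation, Nat.cast_pow, Nat.cast_ofNat] using h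

lemma two_rpow_mul_two_eq (n : ℕ) (c : ℝ) : ((2 : ℝ) ^ n) ^ (2 * c) = ((2 : ℝ) ^ (n * c)) ^ 2 := by
  rw [← Real.rpow_natCast 2 n, ← Real.rpow_natCast _ 2, ← Real.rpow_mul (by norm_num),
    ← Real.rpow_mul (by norm_num)]
  congr 1
  push_cast
  ring

lemma gladyshevXi_le {x : ℝ → ℝ} {n : ℕ} {c : ℝ} (hn : 0 < n) (hc : 0 ≤ c)
    (h : gladyshevS x n ^ 2 ≤ ((2 : ℝ) ^ n) ^ (2 * c)) : gladyshevXi x n ≤ c := by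
  have hn' : (0 : ℝ) < n := Nat.cast_pos.2 hn
  rw [two_rpow_mul_two_eq, sq_le_sq₀ (gladyshevS_nonneg x n) (by positivity)] at h
  rw [gladyshevXi, one_div, inv_mul_le_iff₀ hn']
  rcases (gladyshevS_nonneg x n).eq_or_lt with h0 | h0
  -- If `s_n = 0`, the convention `log 0 = 0` gives `ξ_n = 0`; this is where `0 ≤ c` enters.
  · rw [← h0, Real.logb_zero]
    positivity
  · exact (Real.logb_le_iff_le_rpow one_lt_two h0).2 h

lemma le_gladyshevXi {x : ℝ → ℝ} {n : ℕ} {c : ℝ} (hn : 0 < n)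
    (h : ((2 : ℝ) ^ n) ^ (2 * c) ≤ gladyshevS x n ^ 2) : c ≤ gladyshevXi x n := by
  have hn' : (0 : ℝ) < n := Nat.cast_pos.2 hn
  rw [two_rpow_mul_two_eq, sq_le_sq₀ (by positivity) (gladyshevS_nonneg x n)] at h
  rw [gladyshevXi, one_div, le_inv_mul_iff₀ hn']
  exact (Real.le_logb_iff_rpow_le one_lt_two (lt_of_lt_of_le (by positivity) h)).2 h

lemma gladyshevS_sq_le {x : ℝ → ℝ} {n : ℕ} {c : ℝ} (hn : 0 < n) (h : gladyshevXi x n ≤ c) :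
    gladyshevS x n ^ 2 ≤ ((2 : ℝ) ^ n) ^ (2 * c) := by
  have hn' : (0 : ℝ) < n := Nat.cast_pos.2 hn
  rw [two_rpow_mul_two_eq, sq_le_sq₀ (gladyshevS_nonneg x n) (by positivity)]
  rw [gladyshevXi, one_div, inv_mul_le_iff₀ hn'] at h
  rcases (gladyshevS_nonneg x n).eq_or_lt with h0 | h0
  · rw [← h0]
    positivity
  · exact (Real.logb_le_iff_le_rpow one_lt_two h0).1 h

lemma le_gladyshevS_sq {x : ℝ → ℝ} {n : ℕ} {c : ℝ} (hn : 0 < n) (hc : 0 < c)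
    (h : c ≤ gladyshevXi x n) : ((2 : ℝ) ^ n) ^ (2 * c) ≤ gladyshevS x n ^ 2 := by
  have hn' : (0 : ℝ) < n := Nat.cast_pos.2 hn
  rw [two_rpow_mul_two_eq, sq_le_sq₀ (by positivity) (gladyshevS_nonneg x n)]
  rw [gladyshevXi, one_div, le_inv_mul_iff₀ hn'] at h
  rcases (gladyshevS_nonneg x n).eq_or_lt with h0 | h0
  · rw [← h0, Real.logb_zero] at h
    exact absurd h (not_le.2 (by positivity))
  · exact (Real.le_logb_iff_rpow_le one_lt_two h0).1 h

/-- If `ξ > 1/2`, the quadratic variation does not vanish in the limit. -/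
lemma not_tendsto_dyadicVariation_two_zero {x : ℝ → ℝ} {ξ : ℝ}
    (hξ : Tendsto (gladyshevXi x) atTop (𝓝 ξ)) (h : 1 / 2 < ξ) :
    ¬ Tendsto (dyadicVariation x 2) atTop (𝓝 0) := by
  intro ht
  obtain ⟨n, hn1, hn2, hn0⟩ := ((hξ.eventually_const_le h).and
    ((ht.eventually_lt_const zero_lt_one).and (eventually_gt_atTop 0))).exists
  have h1 := le_gladyshevS_sq hn0 one_half_pos hn1
  rw [show (2 : ℝ) * (1 / 2) = 1 by norm_num, Real.rpow_one, gladyshevS_sq] at h1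
  have h2 := dyadicVariation_nonneg x 2 0
  have h3 : (0 : ℝ) < 2 ^ n := by positivity
  nlinarith

/-- If `ξ < 1/2`, the quadratic variation does not explode. -/
lemma not_tendsto_dyadicVariation_two_atTop {x : ℝ → ℝ} {ξ : ℝ}
    (hξ : Tendsto (gladyshevXi x) atTop (𝓝 ξ)) (h : ξ < 1 / 2) :
    ¬ Tendsto (dyadicVariation x 2) atTop atTop := by
  intro ht
  obtain ⟨n, hn1, hn2, hn0⟩ := ((hξ.eventually_le_const h).and
    ((ht.eventually_gt_atTop (1 + dyadicVariation x 2 0)).and (eventually_gt_atTop 0))).exists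
  have h1 := gladyshevS_sq_le hn0 hn1
  rw [show (2 : ℝ) * (1 / 2) = 1 by norm_num, Real.rpow_one, gladyshevS_sq] at h1
  have h2 := dyadicVariation_nonneg x 2 0
  have h3 : (1 : ℝ) ≤ 2 ^ n := one_le_pow₀ one_le_two
  nlinarith

/-- If the `p`-th variation vanishes for some `p ≥ 2`, then `ξ ≤ 1 - 1/p`. -/
lemma gladyshev_limit_le {x : ℝ → ℝ} {ξ p : ℝ} (hξ : Tendsto (gladyshevXi x) atTop (𝓝 ξ))
    (hp : 2 ≤ p) (ht : Tendsto (dyadicVariation x p) atTop (𝓝 0)) : ξ ≤ 1 - 1 / p := by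
  have hp0 : 0 < p := by linarith
  refine le_of_tendsto hξ ?_
  filter_upwards [ht.eventually_le_const zero_lt_one, eventually_gt_atTop 0] with n hn hn0
  have h1p : 1 / p ≤ 1 := (div_le_one hp0).2 (by linarith)
  refine gladyshevXi_le hn0 (by linarith) ?_
  have h2n : (0 : ℝ) < 2 ^ n := by positivity
  have h := dyadicVariation_rpow_le x two_pos hp n
  have h' : dyadicVariation x 2 n ^ (p / 2) ≤ (((2 : ℝ) ^ n) ^ (1 - 2 / p)) ^ (p / 2) := by
    rw [← Real.rpow_mul h2n.le, show (1 - 2 / p) * (p / 2) = p / 2 - 1 by field_simp]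
    exact h.trans (mul_le_of_le_one_right (by positivity) hn)
  rw [Real.rpow_le_rpow_iff (dyadicVariation_nonneg x 2 n) (by positivity) (by positivity)] at h'
  have h0 := dyadicVariation_nonneg x 2 0
  calc gladyshevS x n ^ 2 ≤ 2 ^ n * dyadicVariation x 2 n := by
        rw [gladyshevS_sq]
        linarith
    _ ≤ 2 ^ n * ((2 : ℝ) ^ n) ^ (1 - 2 / p) := by gcongr
    _ = ((2 : ℝ) ^ n) ^ (2 * (1 - 1 / p)) := by
        rw [← Real.rpow_one_add' h2n.le]
        · congr 1
          ring
        · have : 2 / p ≤ 1 := (div_le_one hp0).2 hp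
          linarith

/-- If the `p`-th variation explodes for some `1 ≤ p ≤ 2`, then `1 - 1/p ≤ ξ`. -/
lemma le_gladyshev_limit {x : ℝ → ℝ} {ξ p : ℝ} (hξ : Tendsto (gladyshevXi x) atTop (𝓝 ξ))
    (hp1 : 1 ≤ p) (hp2 : p ≤ 2) (ht : Tendsto (dyadicVariation x p) atTop atTop) :
    1 - 1 / p ≤ ξ := by
  have hp0 : 0 < p := by linarith
  refine ge_of_tendsto hξ ?_
  have ht' := (tendsto_rpow_atTop (show 0 < 2 / p by positivity)).comp ht
  -- The summand `V_0` in the threshold absorbs the `- V_0` in `gladyshevS_sq`.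
  filter_upwards [ht'.eventually_ge_atTop (1 + dyadicVariation x 2 0), eventually_gt_atTop 0]
    with n hn hn0
  refine le_gladyshevXi hn0 ?_
  have h2n : (0 : ℝ) < 2 ^ n := by positivity
  have h0 := dyadicVariation_nonneg x 2 0
  have h := hn.trans (dyadicVariation_rpow_le x hp0 hp2 n)
  have h1p : 1 / p ≤ 1 := (div_le_one hp0).2 hp1
  have h1 : (1 : ℝ) ≤ ((2 : ℝ) ^ n) ^ (2 * (1 - 1 / p)) :=
    Real.one_le_rpow (one_le_pow₀ one_le_two) (by linarith)
  have h2 : ((2 : ℝ) ^ n) ^ (2 * (1 - 1 / p)) * ((2 : ℝ) ^ n) ^ (2 / p - 1) = 2 ^ n := by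
    rw [← Real.rpow_add h2n, show 2 * (1 - 1 / p) + (2 / p - 1) = 1 by ring, Real.rpow_one]
  have h3 : ((2 : ℝ) ^ n) ^ (2 * (1 - 1 / p)) * (1 + dyadicVariation x 2 0) ≤
      2 ^ n * dyadicVariation x 2 n := by
    refine (mul_le_mul_of_nonneg_left h (by positivity)).trans_eq ?_
    rw [← mul_assoc, h2]
  rw [gladyshevS_sq]
  nlinarith

lemma gladyshev_limit_nonneg {x : ℝ → ℝ} {ξ : ℝ} (hξ : Tendsto (gladyshevXi x) atTop (𝓝 ξ)) :
    0 ≤ ξ := by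
  by_cases h : ∀ n, gladyshevS x n = 0
  · refine ge_of_tendsto' hξ fun n => ?_
    simp [gladyshevXi, h n]
  · push Not at h
    obtain ⟨N, hN⟩ := h
    have hN0 : 0 < gladyshevS x N := (gladyshevS_nonneg x N).lt_of_ne' hN
    have hlim : Tendsto (fun n : ℕ => 1 / (n : ℝ) * Real.logb 2 (gladyshevS x N)) atTop (𝓝 0) := by
      simpa using tendsto_one_div_atTop_nhds_zero_nat.mul_const (Real.logb 2 (gladyshevS x N))
    refine le_of_tendsto_of_tendsto hlim hξ ?_
    filter_upwards [eventually_ge_atTop N] with n hn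
    exact mul_le_mul_of_nonneg_left
      (Real.logb_le_logb_of_le one_lt_two hN0 (gladyshevS_mono x hn)) (by positivity)

theorem mainTheorem6 (x : ℝ → ℝ) (hx : ContinuousOn x (Set.Icc 0 1)) (H ξ : ℝ)
    (hH : HasHurstRoughnessExponent x H)
    (hξ : Tendsto (gladyshevXi x) atTop (𝓝 ξ)) :
    (1 / 2 < ξ → H ≤ 1 / 2) ∧
    (ξ < 1 / 2 → 1 / 2 ≤ H) ∧
    (H ≤ 1 / 2 → H ≤ 1 - ξ) ∧
    (1 / 2 ≤ H → 1 - ξ ≤ H) := by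
  obtain ⟨q, hq1, rfl, hzero, htop⟩ := hH
  have hq0 : 0 < q := by linarith
  have hcont : ContinuousAt (fun p : ℝ => 1 - 1 / p) q :=
    continuousAt_const.sub (continuousAt_const.div continuousAt_id hq0.ne')
  refine ⟨fun h => ?_, fun h => ?_, fun h => ?_, fun h => ?_⟩
  · refine one_div_le_one_div_of_le two_pos (not_lt.1 fun hq => ?_)
    exact not_tendsto_dyadicVariation_two_zero hξ h (hzero 2 hq)
  · refine one_div_le_one_div_of_le hq0 (not_lt.1 fun hq => ?_)
    exact not_tendsto_dyadicVariation_two_atTop hξ h (htop 2 two_pos hq)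
  · have hq2 : 2 ≤ q := (one_div_le_one_div hq0 two_pos).1 h
    have hle : ξ ≤ 1 - 1 / q := by
      refine ge_of_tendsto (hcont.tendsto.mono_left (nhdsWithin_le_nhds (s := Set.Ioi q))) ?_
      filter_upwards [self_mem_nhdsWithin] with p hp
      exact gladyshev_limit_le hξ (hq2.trans (le_of_lt hp)) (hzero p hp)
    linarith
  · have hq2 : q ≤ 2 := (one_div_le_one_div two_pos hq0).1 h
    have hle : 1 - 1 / q ≤ ξ := by
      rcases hq1.eq_or_lt with rfl | hq1'
      -- For `q = 1` no `p` with `1 ≤ p < q` exists; the bound is just `0 ≤ ξ`, true since `s_n` is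
      -- monotone.
      · simpa using gladyshev_limit_nonneg hξ
      · refine le_of_tendsto (hcont.tendsto.mono_left (nhdsWithin_le_nhds (s := Set.Iio q))) ?_
        filter_upwards [Ioo_mem_nhdsLT hq1'] with p hp
        exact le_gladyshev_limit hξ hp.1.le (hp.2.le.trans hq2) (htop p (by linarith [hp.1]) hp.2)
    linarith
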